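/- Let $n\ge 1$, let $\Omega\subset\mathbb C$ be a nonempty connected open set and $\Omega^*=\{\bar\lambda:\lambda\in\Omega\}$. $\mathcal B_n(\Omega)$ denotes the class of bounded operators $T$ on a complex Hilbert space $\mathcal H$ such that $\Omega\subset\sigma(T)$, $\operatorname{ran}(T-\lambda)=\mathcal H$ and $\dim\ker(T-\lambda)=n$ for every $\lambda\in\Omega$, and $\bigvee_{\lambda\in\Omega}\ker(T-\lambda)=\mathcal H$. We write $T=(M_z^*,\mathcal H,K)$ if $\mathcal H$ is a Hilbert space of holomorphic $\mathbb C^n$-valued functions on $\Omega^*$ with $n\times n$-matrix-valued reproducing kernel $K$, $K(\mu,\mu)$ is invertible for every $\mu\in\Omega^*$, and $T$ is the adjoint of multiplication by the coordinate function $z$ on $\mathcal H$. For $T \in \mathcal B_n(\Omega)$ let $E_T$ be the bundle over $\Omega$ with fibre $\ker(T-\lambda)$ at $\lambda$. If $\gamma=(\gamma_1,\dots,\gamma_n)$ is a holomorphic frame of $E_T$ over $\Omega$, put $h_\gamma(\lambda)=(\langle\gamma_j(\lambda),\gamma_i(\lambda)\rangle)_{i,j=1}^n$; the connection matrix of $E_T$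 in the frame $\gamma$ is $\Theta=h_\gamma^{-1}\frac{\partial}{\partial\lambda}h_\gamma$. For $T=(M_z^*,\mathcal H,K)$ the kernel frame is $\gamma_j(\lambda)=K(\cdot,\bar\lambda)e_j$, whose metric is $h(\lambda)=K(\bar\lambda,\bar\lambda)$. Let $T,S\in\mathcal B_n(\Omega)$ with $T=(M_z^*,\mathcal H_T,K_T)$ and $S=(M_z^*,\mathcal H_S,K_S)$, and let $\Theta_T,\Theta_S$ be the connection matrices of $E_T,E_S$ in the kernel frames, that is, $\Theta_T(\lambda)=h_T(\lambda)^{-1}\frac{\partial}{\partial\lambda}h_T(\lambda)$ with $h_T(\lambda)=K_T(\bar\lambda,\bar\lambda)$, and likewise for $S$. Then $T$ and $S$ are unitarily equivalent (there is a unitary $U:\mathcal H_T\to\mathcal H_S$ with $UT=SU$) if and only if there are a nonempty open set $\Lambda\subset\Omega$ and a holomorphic function $\Phi:\Lambda\to\mathcal M_n(\mathbb C)$ with $\Phi(\lambda)$ invertible for every $\lambda\in\Lambda$ such that $$\Theta_T=\Phi^{-1}\Theta_S\Phi+\Phi^{-1}\Phi'\quad\text{on }\Lambda .$$ The same equivalence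 holds when $\Theta_T,\Theta_S$ are the connection matrices of $E_T,E_S$ in any given holomorphic frames over $\Omega$. -/

import Mathlib

open scoped ComplexConjugate

noncomputable section

/-- The conjugate domain `Ω* = {z : conj z ∈ Ω}`. -/
def conjDomain (Ω : Set ℂ) : Set ℂ := {z | conj z ∈ Ω}

/-- The Cowen-Douglas class `B_n(Ω)`. -/
structure CowenDouglas {H : Type*} [NormedAddCommGroup H] [InnerProductSpace ℂ H]
    (n : ℕ) (Ω : Set ℂ) (T : H →L[ℂ] H) : Prop where
  subset_spectrum : Ω ⊆ spectrum ℂ T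
  surjective : ∀ l ∈ Ω, Function.Surjective fun x : H => T x - l • x
  dense_span : (⨆ l ∈ Ω, Module.End.eigenspace (T : H →ₗ[ℂ] H) l).topologicalClosure = ⊤
  rank_ker : ∀ l ∈ Ω, Module.rank ℂ (Module.End.eigenspace (T : H →ₗ[ℂ] H) l) = n

/-- Unitary equivalence of operators, the unitary being allowed to act between two Hilbert
spaces. -/
def UnitarilyEquivalent {H₁ H₂ : Type*} [NormedAddCommGroup H₁] [InnerProductSpace ℂ H₁]
    [NormedAddCommGroup H₂] [InnerProductSpace ℂ H₂]
    (T : H₁ →L[ℂ] H₁) (S : H₂ →L[ℂ] H₂) : Prop :=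
  ∃ U : H₁ ≃ₗᵢ[ℂ] H₂, ∀ x, U (T x) = S (U x)

/-- The `n × n` matrix `K(z, w)` of the reproducing kernel of a Hilbert space of `ℂⁿ`-valued
functions on `Ω*`. -/
def kernelMatrix {n : ℕ} {Ω : Set ℂ} (H : Type*) [NormedAddCommGroup H] [InnerProductSpace ℂ H]
    [CompleteSpace H] [RKHS ℂ H (conjDomain Ω) (EuclideanSpace ℂ (Fin n))]
    (z w : conjDomain Ω) : Matrix (Fin n) (Fin n) ℂ :=
  Matrix.of fun i j => RKHS.kernel H z w (EuclideanSpace.single j 1) i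

/-- `T = (M_z^*, H, K)`: the elements of the reproducing kernel Hilbert space `H` are holomorphic
`ℂⁿ`-valued functions on `Ω*`, the operator `T` is the adjoint of multiplication by the coordinate
function, and `K(z, z)` is invertible for every `z` in `Ω*`. -/
structure IsKernelRealization {n : ℕ} {Ω : Set ℂ} {H : Type*} [NormedAddCommGroup H]
    [InnerProductSpace ℂ H] [CompleteSpace H]
    [RKHS ℂ H (conjDomain Ω) (EuclideanSpace ℂ (Fin n))] (T : H →L[ℂ] H) : Prop where
  holomorphic : ∀ f : H, ∃ F : ℂ → EuclideanSpace ℂ (Fin n),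
    DifferentiableOn ℂ F (conjDomain Ω) ∧ ∀ z : conjDomain Ω, F z = f z
  adjoint_apply : ∀ (f : H) (z : conjDomain Ω),
    (ContinuousLinearMap.adjoint T f) z = (z : ℂ) • f z
  isUnit_kernel : ∀ z : conjDomain Ω, IsUnit (kernelMatrix H z z)

/-- A holomorphic frame over `Ω` of the bundle `E_T` with fibre `ker (T - l)` over `l`. -/
structure IsHolomorphicFrame {n : ℕ} {H : Type*} [NormedAddCommGroup H] [InnerProductSpace ℂ H]
    (T : H →L[ℂ] H) (Ω : Set ℂ) (γ : Fin n → ℂ → H) : Prop where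
  differentiableOn : ∀ i, DifferentiableOn ℂ (γ i) Ω
  linearIndependent : ∀ l ∈ Ω, LinearIndependent ℂ fun i => γ i l
  span_eq : ∀ l ∈ Ω, Submodule.span ℂ (Set.range fun i => γ i l) =
    Module.End.eigenspace (T : H →ₗ[ℂ] H) l

/-- The metric `h = (⟨γ_j, γ_i⟩)_{i,j}` of a frame, where `⟨x, y⟩` is linear in `x`
(Mathlib's `inner ℂ y x`). -/
def gramMetric {n : ℕ} {H : Type*} [NormedAddCommGroup H] [InnerProductSpace ℂ H]
    (γ : Fin n → ℂ → H) (l : ℂ) : Matrix (Fin n) (Fin n) ℂ :=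
  Matrix.of fun i j => inner ℂ (γ i l) (γ j l)

open Classical in
/-- The frame `γ_j(l) = K(·, conj l) e_j` given by the reproducing kernel
(extended by zero outside `Ω`). -/
def kernelFrame {n : ℕ} {Ω : Set ℂ} (H : Type*) [NormedAddCommGroup H] [InnerProductSpace ℂ H]
    [CompleteSpace H] [RKHS ℂ H (conjDomain Ω) (EuclideanSpace ℂ (Fin n))]
    (j : Fin n) (l : ℂ) : H :=
  if hl : conj l ∈ conjDomain Ω then
    RKHS.kerFun H (⟨conj l, hl⟩ : conjDomain Ω) (EuclideanSpace.single j (1 : ℂ)) else 0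

/-- The metric of the kernel frame is `h(l) = K(conj l, conj l)`. -/
theorem gramMetric_kernelFrame {n : ℕ} {Ω : Set ℂ} (H : Type*) [NormedAddCommGroup H]
    [InnerProductSpace ℂ H] [CompleteSpace H]
    [RKHS ℂ H (conjDomain Ω) (EuclideanSpace ℂ (Fin n))] (l : ℂ) (hl : conj l ∈ conjDomain Ω) :
    gramMetric (kernelFrame (Ω := Ω) H) l = kernelMatrix (n := n) (Ω := Ω) H ⟨conj l, hl⟩ ⟨conj l, hl⟩ := by
  ext i j
  simp only [gramMetric, kernelFrame, kernelMatrix, Matrix.of_apply, dif_pos hl]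
  rw [RKHS.kerFun_inner, RKHS.kerFun_apply, EuclideanSpace.inner_single_left]
  simp

/-- The Wirtinger derivative `∂f/∂l = (∂f/∂x - i ∂f/∂y) / 2`. -/
def wirtinger (f : ℂ → ℂ) (l : ℂ) : ℂ :=
  (fderiv ℝ f l 1 - Complex.I * fderiv ℝ f l Complex.I) / 2

/-- The connection matrix `Θ = h⁻¹ ∂h/∂l` of the canonical connection in a holomorphic frame with
metric `h`. -/
def connectionMatrix {n : ℕ} (h : ℂ → Matrix (Fin n) (Fin n) ℂ) (l : ℂ) :
    Matrix (Fin n) (Fin n) ℂ :=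
  (h l)⁻¹ * Matrix.of fun i j => wirtinger (fun z => h z i j) l

/-- There are a nonempty open set `U ⊆ Ω` and a holomorphic invertible matrix function `Φ` on `U`
with `Θ₁ = Φ⁻¹ Θ₂ Φ + Φ⁻¹ Φ'` on `U`. -/
def HolomorphicGaugeEquivalent {n : ℕ} (Ω : Set ℂ) (Θ₁ Θ₂ : ℂ → Matrix (Fin n) (Fin n) ℂ) :
    Prop :=
  ∃ U : Set ℂ, U ⊆ Ω ∧ IsOpen U ∧ U.Nonempty ∧ ∃ Φ : ℂ → Matrix (Fin n) (Fin n) ℂ,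
    (∀ i j, DifferentiableOn ℂ (fun z => Φ z i j) U) ∧ (∀ l ∈ U, IsUnit (Φ l)) ∧
    ∀ l ∈ U, Θ₁ l = (Φ l)⁻¹ * Θ₂ l * Φ l +
      (Φ l)⁻¹ * Matrix.of fun i j => deriv (fun z => Φ z i j) l

end

/-! The kernel frame plays no special role: it is one holomorphic frame
(`isHolomorphicFrame_kernelFrame`), so everything reduces to arbitrary frames `γT`, `γS`.

If a unitary `U` intertwines, it maps fibres to fibres, so `U γT = γS Φ` with `Φ` holomorphic near a
point. Then `h_T = Φᴴ h_S Φ` and `∂h_T = Φᴴ (∂h_S Φ + h_S Φ')`, and the gauge relation follows by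
dividing.

Conversely, polarize the metric to `K(z, w) = ⟨γ(z), γ(conj w)⟩`, holomorphic in both variables. The
gauge relation, known on `w = conj z`, holds for all nearby `(z, w)` (`eq_zero_of_eq_zero_conj`).
For fixed `w` it says that `K_T(·, w)` and `K_S(·, w) Φ` solve the same linear equation `X' = X Ξ`,
so they differ by a left factor depending on `w` only (`Matrix.eq_mul_of_hasDerivAt`). Hermitian
symmetry rigidifies this factor: after normalization at a base point it is a constant positive
matrix commuting with the kernel, and its square root turns the one-sided factor into a congruence
(`exists_congruence_of_eq_mul`). Thus `γT` and a modified frame of `E_S` have equal inner products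
between any two points of a small disc. Since eigenvectors over a disc already span densely
(`dense_span_of_isHolomorphicFrame`), a unitary matching them exists and intertwines `T` and `S`. -/

noncomputable section

/-! ### Congruence of Hermitian matrix kernels -/

open scoped ComplexOrder MatrixOrder Matrix in
/-- A positive definite matrix has an invertible Hermitian square root which commutes with
everything the matrix commutes with. -/
theorem Matrix.PosDef.exists_sqrt {n : ℕ} {C : Matrix (Fin n) (Fin n) ℂ} (hC : C.PosDef) :
    ∃ B : Matrix (Fin n) (Fin n) ℂ, Bᴴ = B ∧ IsUnit B ∧ B * B = C ∧ ∀ X, C * X = X * C → B * X = X * B := by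
  have h0 : 0 ≤ C := Matrix.nonneg_iff_posSemidef.2 hC.posSemidef
  have hsq : CFC.sqrt C * CFC.sqrt C = C := CFC.sqrt_mul_sqrt_self C
  refine ⟨CFC.sqrt C, ?_, ?_, hsq, fun X hX => ?_⟩
  · exact (Matrix.nonneg_iff_posSemidef.1 (CFC.sqrt_nonneg C)).1
  · exact IsUnit.of_mul_eq_one (CFC.sqrt C * C⁻¹) (by
      rw [← mul_assoc, hsq, Matrix.mul_nonsing_inv _ ((Matrix.isUnit_iff_isUnit_det _).1 hC.isUnit)])
  · rw [CFC.sqrt_eq_cfc]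
    exact (Commute.cfc_nnreal (show Commute C X from hX) _).eq

open scoped ComplexOrder Matrix in
/-- Two Hermitian kernels of matrices which differ by a left factor depending on the second
variable only, the second being normalized at `a`, are congruent by a constant matrix. -/
theorem exists_congruence_of_eq_mul_of_normalized {n : ℕ} {V : Set ℂ} {a : ℂ} (ha : a ∈ V)
    {K L : ℂ → ℂ → Matrix (Fin n) (Fin n) ℂ} (A : ℂ → Matrix (Fin n) (Fin n) ℂ)
    (hK : ∀ z ∈ V, ∀ w ∈ V, (K z w)ᴴ = K w z) (hL : ∀ z ∈ V, ∀ w ∈ V, (L z w)ᴴ = L w z)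
    (hKa : (K a a).PosDef) (hLa : ∀ z ∈ V, L z a = 1)
    (hA : ∀ z ∈ V, ∀ w ∈ V, K z w = A w * L z w) :
    ∃ Q : Matrix (Fin n) (Fin n) ℂ, Qᴴ = Q ∧ IsUnit Q ∧
      ∀ z ∈ V, ∀ w ∈ V, K z w = Q * L z w * Q := by
  have hLa' : ∀ w ∈ V, L a w = 1 := fun w hw => by
    rw [← hL w hw a ha, hLa w hw, Matrix.conjTranspose_one]
  have h1 : ∀ z ∈ V, K z a = A a := fun z hz => by rw [hA z hz a ha, hLa z hz, mul_one]
  have h2 : ∀ w ∈ V, K a w = A w := fun w hw => by rw [hA a ha w hw, hLa' w hw, mul_one]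
  -- The factor is constant: `A w = K a w = (K w a)ᴴ = (A a)ᴴ = (K a a)ᴴ = K a a`.
  have hC : ∀ w ∈ V, A w = K a a := fun w hw => by
    rw [← h2 w hw, ← hK w hw a ha, h1 w hw, ← h1 a ha, hK a ha a ha]
  have h3 : ∀ z ∈ V, ∀ w ∈ V, K z w = K a a * L z w := fun z hz w hw => by
    rw [hA z hz w hw, hC w hw]
  obtain ⟨Q, hQ, hQu, hQQ, hQc⟩ := hKa.exists_sqrt
  refine ⟨Q, hQ, hQu, fun z hz w hw => ?_⟩
  -- Taking adjoints in `K = C L` with `C = K a a` gives `K = L C`; so `C`, and hence its square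
  -- root, commutes with `L`.
  have h4 : K a a * L z w = L z w * K a a := by
    have := hK w hw z hz
    rw [h3 w hw z hz, h3 z hz w hw, Matrix.conjTranspose_mul, hL w hw z hz, hK a ha a ha] at this
    exact this.symm
  rw [h3 z hz w hw, mul_assoc, ← hQc _ h4, ← mul_assoc, hQQ]

open scoped ComplexOrder Matrix in
/-- Two Hermitian kernels of matrices which differ by a left factor depending on the second
variable only are congruent by a matrix function of one variable. -/
theorem exists_congruence_of_eq_mul {n : ℕ} {V : Set ℂ} {a : ℂ} (ha : a ∈ V)
    {K L : ℂ → ℂ → Matrix (Fin n) (Fin n) ℂ} (A : ℂ → Matrix (Fin n) (Fin n) ℂ)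
    (hK : ∀ z ∈ V, ∀ w ∈ V, (K z w)ᴴ = K w z) (hL : ∀ z ∈ V, ∀ w ∈ V, (L z w)ᴴ = L w z)
    (hKa : (K a a).PosDef) (hLa : (L a a).PosDef) (hLu : ∀ z ∈ V, IsUnit (L z a))
    (hA : ∀ z ∈ V, ∀ w ∈ V, K z w = A w * L z w) :
    ∃ W : ℂ → Matrix (Fin n) (Fin n) ℂ, (∀ z ∈ V, IsUnit (W z)) ∧
      ∀ z ∈ V, ∀ w ∈ V, K z w = (W w)ᴴ * L z w * W z := by
  obtain ⟨R, hR, hRu, hRR, -⟩ := hLa.exists_sqrt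
  have hRdet := (Matrix.isUnit_iff_isUnit_det _).1 hRu
  have hdet : ∀ z ∈ V, IsUnit (L z a).det := fun z hz =>
    (Matrix.isUnit_iff_isUnit_det _).1 (hLu z hz)
  -- `M` normalizes `L` at `a`: as `R * R = L a a`, `M a = R⁻¹`, whence `(M a)ᴴ * L z a * M z = 1`.
  -- `N` is the pointwise inverse of `M` and undoes the normalization at the end.
  set M : ℂ → Matrix (Fin n) (Fin n) ℂ := fun z => (L z a)⁻¹ * R with hM
  set N : ℂ → Matrix (Fin n) (Fin n) ℂ := fun z => R⁻¹ * L z a with hN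
  have hMN : ∀ z ∈ V, M z * N z = 1 := fun z hz => by
    simp only [hM, hN]
    rw [mul_assoc, Matrix.mul_nonsing_inv_cancel_left _ _ hRdet, Matrix.nonsing_inv_mul _ (hdet z hz)]
  have hNM : ∀ z ∈ V, N z * M z = 1 := fun z hz => mul_eq_one_comm.1 (hMN z hz)
  have hNM' : ∀ z ∈ V, (N z)ᴴ * (M z)ᴴ = 1 := fun z hz => by
    rw [← Matrix.conjTranspose_mul, hMN z hz, Matrix.conjTranspose_one]
  have hMa : (M a)ᴴ = R⁻¹ := by
    simp only [hM]
    rw [← hRR, Matrix.mul_inv_rev, mul_assoc, Matrix.nonsing_inv_mul _ hRdet, mul_one,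
      Matrix.conjTranspose_nonsing_inv, hR]
  obtain ⟨Q, hQ, hQu, hKL⟩ := exists_congruence_of_eq_mul_of_normalized ha
    (K := fun z w => (M w)ᴴ * K z w * M z) (L := fun z w => (M w)ᴴ * L z w * M z)
    (fun w => (M w)ᴴ * A w * (N w)ᴴ)
    (fun z hz w hw => by simp [Matrix.conjTranspose_mul, hK z hz w hw, mul_assoc])
    (fun z hz w hw => by simp [Matrix.conjTranspose_mul, hL z hz w hw, mul_assoc])
    (hKa.conjTranspose_mul_mul_same (Matrix.mulVec_injective_of_isUnit
      (IsUnit.of_mul_eq_one _ (hMN a ha))))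
    (fun z hz => by
      rw [hMa, mul_assoc]; simp only [hM]
      rw [Matrix.mul_nonsing_inv_cancel_left _ _ (hdet z hz), Matrix.nonsing_inv_mul _ hRdet])
    (fun z hz w hw => by
      simp only [hA z hz w hw, mul_assoc]
      rw [← mul_assoc (N w)ᴴ, hNM' w hw, one_mul])
  refine ⟨fun z => M z * Q * N z, fun z hz => ?_, fun z hz w hw => ?_⟩
  · exact ((IsUnit.of_mul_eq_one _ (hMN z hz)).mul hQu).mul (IsUnit.of_mul_eq_one _ (hNM z hz))
  · have h := hKL z hz w hw
    calc K z w = (N w)ᴴ * ((M w)ᴴ * K z w * M z) * N z := by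
          simp only [mul_assoc]
          rw [hMN z hz, ← mul_assoc (N w)ᴴ, hNM' w hw, one_mul, mul_one]
      _ = _ := by
          rw [h]; simp only [Matrix.conjTranspose_mul, hQ, mul_assoc]

/-! ### Unitaries from equal Gram matrices -/

/-- Two families of vectors with the same Gram matrix and dense spans are exchanged by a unitary. -/
theorem exists_linearIsometryEquiv_of_inner_eq {ι H₁ H₂ : Type*}
    [NormedAddCommGroup H₁] [InnerProductSpace ℂ H₁] [CompleteSpace H₁]
    [NormedAddCommGroup H₂] [InnerProductSpace ℂ H₂] [CompleteSpace H₂]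
    (x : ι → H₁) (y : ι → H₂) (hx : (Submodule.span ℂ (Set.range x)).topologicalClosure = ⊤)
    (hy : (Submodule.span ℂ (Set.range y)).topologicalClosure = ⊤)
    (h : ∀ i j, inner ℂ (x i) (x j) = inner ℂ (y i) (y j)) :
    ∃ U : H₁ ≃ₗᵢ[ℂ] H₂, ∀ i, U (x i) = y i := by
  have hn : ∀ c : ι →₀ ℂ, ‖Finsupp.linearCombination ℂ y c‖ = ‖Finsupp.linearCombination ℂ x c‖ := by
    intro c
    have h2 : ∀ c : ι →₀ ℂ, inner ℂ (Finsupp.linearCombination ℂ y c)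
        (Finsupp.linearCombination ℂ y c) = inner ℂ (Finsupp.linearCombination ℂ x c)
        (Finsupp.linearCombination ℂ x c) := by
      intro c
      simp only [Finsupp.linearCombination_apply, Finsupp.sum, sum_inner, inner_sum,
        inner_smul_left, inner_smul_right, h]
    rw [@norm_eq_sqrt_re_inner ℂ, @norm_eq_sqrt_re_inner ℂ, h2]
  have hdx : DenseRange (Finsupp.linearCombination ℂ x) := by
    rw [← Finsupp.range_linearCombination, ← Submodule.dense_iff_topologicalClosure_eq_top] at hx
    exact hx
  have hdy : DenseRange (Finsupp.linearCombination ℂ y) := by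
    rw [← Finsupp.range_linearCombination, ← Submodule.dense_iff_topologicalClosure_eq_top] at hy
    exact hy
  refine ⟨LinearEquiv.extendOfIsometry (LinearEquiv.refl ℂ (ι →₀ ℂ)) (Finsupp.linearCombination ℂ x)
    (Finsupp.linearCombination ℂ y) hdx hdy hn, fun i => ?_⟩
  simpa using LinearEquiv.extendOfIsometry_eq (LinearEquiv.refl ℂ (ι →₀ ℂ))
    (Finsupp.linearCombination ℂ x) (Finsupp.linearCombination ℂ y) hdx hdy hn
    (Finsupp.single i 1)

/-- Two operators with dense families of eigenvectors, of the same eigenvalues and the same Gram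
matrix, are unitarily equivalent. -/
theorem unitarilyEquivalent_of_inner_eq {ι H₁ H₂ : Type*}
    [NormedAddCommGroup H₁] [InnerProductSpace ℂ H₁] [CompleteSpace H₁]
    [NormedAddCommGroup H₂] [InnerProductSpace ℂ H₂] [CompleteSpace H₂]
    {T : H₁ →L[ℂ] H₁} {S : H₂ →L[ℂ] H₂} (l : ι → ℂ)
    (x : ι → H₁) (y : ι → H₂) (hx : (Submodule.span ℂ (Set.range x)).topologicalClosure = ⊤)
    (hy : (Submodule.span ℂ (Set.range y)).topologicalClosure = ⊤)
    (hT : ∀ i, T (x i) = l i • x i) (hS : ∀ i, S (y i) = l i • y i)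
    (h : ∀ i j, inner ℂ (x i) (x j) = inner ℂ (y i) (y j)) :
    UnitarilyEquivalent T S := by
  obtain ⟨U, hU⟩ := exists_linearIsometryEquiv_of_inner_eq x y hx hy h
  refine ⟨U, fun v => ?_⟩
  have : (U.toContinuousLinearEquiv : H₁ →L[ℂ] H₂) ∘L T =
      S ∘L (U.toContinuousLinearEquiv : H₁ →L[ℂ] H₂) := by
    refine ContinuousLinearMap.ext_on (s := Set.range x)
      (Submodule.dense_iff_topologicalClosure_eq_top.2 hx) ?_
    rintro _ ⟨i, rfl⟩
    simp [hT, hS, hU]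
  exact DFunLike.congr_fun this v

/-! ### Identity principles and polarization -/

/-- Identity principle: a holomorphic function on a disc vanishing on the real diameter vanishes. -/
theorem eq_zero_of_eq_zero_real {F : Type*} [NormedAddCommGroup F] [NormedSpace ℂ F]
    [CompleteSpace F] {f : ℂ → F} {r : ℝ} (hf : DifferentiableOn ℂ f (Metric.ball 0 r))
    (h0 : ∀ x : ℝ, |x| < r → f x = 0) : ∀ z ∈ Metric.ball (0 : ℂ) r, f z = 0 := by
  intro z hz
  have hr : 0 < r := Metric.pos_of_mem_ball hz
  have hfa : AnalyticOnNhd ℂ f (Metric.ball 0 r) := hf.analyticOnNhd Metric.isOpen_ball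
  refine hfa.eqOn_zero_of_preconnected_of_mem_closure
    (convex_ball (0 : ℂ) r).isPreconnected (Metric.mem_ball_self hr) ?_ hz
  rw [Metric.mem_closure_iff]
  intro ε hε
  have hm : 0 < min ε r := lt_min hε hr
  have h1 : |min ε r / 2| = min ε r / 2 := abs_of_pos (by positivity)
  refine ⟨((min ε r / 2 : ℝ) : ℂ), ⟨h0 _ ?_, ?_⟩, ?_⟩
  · rw [h1]; linarith [min_le_right ε r]
  · simp only [Set.mem_singleton_iff, Complex.ofReal_eq_zero]; positivity
  · rw [dist_zero_left, Complex.norm_real, Real.norm_eq_abs, h1]; linarith [min_le_left ε r]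

/-- Identity principle: a holomorphic function of two variables which vanishes at the points
`(z, conj z)` vanishes. -/
theorem eq_zero_of_eq_zero_conj {F : Type*} [NormedAddCommGroup F] [NormedSpace ℂ F]
    [CompleteSpace F] {G : ℂ × ℂ → F} {a : ℂ} {r : ℝ}
    (hG : DifferentiableOn ℂ G (Metric.ball a r ×ˢ Metric.ball (conj a) r))
    (h0 : ∀ z ∈ Metric.ball a r, G (z, conj z) = 0) :
    ∀ z ∈ Metric.ball a (r / 2), ∀ w ∈ Metric.ball (conj a) (r / 2), G (z, w) = 0 := by
  -- Coordinates in which the antidiagonal `w = conj z` is the set of real `(s, t)`; the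
  -- one-variable principle is then applied in `t` for real `s`, and in `s` for arbitrary `t`.
  set q : ℂ → ℂ → ℂ × ℂ := fun s t => (a + (s + Complex.I * t), conj a + (s - Complex.I * t))
  have hq : ∀ s ∈ Metric.ball (0 : ℂ) (r / 2), ∀ t ∈ Metric.ball (0 : ℂ) (r / 2),
      q s t ∈ Metric.ball a r ×ˢ Metric.ball (conj a) r := by
    intro s hs t ht
    rw [mem_ball_zero_iff] at hs ht
    have hI : ‖Complex.I * t‖ = ‖t‖ := by simp
    simp only [q, Set.mem_prod, mem_ball_iff_norm, add_sub_cancel_left]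
    exact ⟨by linarith [norm_add_le s (Complex.I * t)], by linarith [norm_sub_le s (Complex.I * t)]⟩
  have hreal : ∀ x : ℝ, |x| < r / 2 → (x : ℂ) ∈ Metric.ball (0 : ℂ) (r / 2) := fun x hx => by
    rwa [mem_ball_zero_iff, Complex.norm_real, Real.norm_eq_abs]
  have h1 : ∀ x : ℝ, |x| < r / 2 → ∀ t ∈ Metric.ball (0 : ℂ) (r / 2), G (q x t) = 0 := by
    intro x hx
    refine eq_zero_of_eq_zero_real (f := fun t => G (q x t)) ?_ ?_
    · exact hG.comp (f := fun t => q x t) (by fun_prop) (fun t ht => hq _ (hreal x hx) t ht)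
    · intro y hy
      have : q x y = (a + (x + Complex.I * y), conj (a + (x + Complex.I * y))) := by
        simp [q, sub_eq_add_neg]
      simp only [this]
      exact h0 _ (this ▸ hq _ (hreal x hx) _ (hreal y hy)).1
  have h2 : ∀ t ∈ Metric.ball (0 : ℂ) (r / 2), ∀ s ∈ Metric.ball (0 : ℂ) (r / 2),
      G (q s t) = 0 := by
    intro t ht
    refine eq_zero_of_eq_zero_real (f := fun s => G (q s t)) ?_ (fun x hx => h1 x hx t ht)
    exact hG.comp (f := fun s => q s t) (by fun_prop) (fun s hs => hq s hs t ht)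
  intro z hz w hw
  rw [mem_ball_iff_norm] at hz hw
  have := h2 (((z - a) - (w - conj a)) / (2 * Complex.I)) (by
      rw [mem_ball_zero_iff, norm_div]
      have := norm_sub_le (z - a) (w - conj a)
      simp only [norm_mul, Complex.norm_ofNat, Complex.norm_I, mul_one]
      linarith) (((z - a) + (w - conj a)) / 2) (by
      rw [mem_ball_zero_iff, norm_div]
      have := norm_add_le (z - a) (w - conj a)
      simp only [Complex.norm_ofNat]
      linarith)
  convert this using 2
  simp only [q, Prod.mk.injEq]
  constructor <;> field_simp <;> ring

/-! ### Holomorphic functions with values in a Hilbert space -/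

/-- If `u` is holomorphic, so is `z ↦ ⟨u (conj z), ·⟩`. -/
theorem hasDerivAt_innerSL_conj {H : Type*} [NormedAddCommGroup H] [InnerProductSpace ℂ H]
    {u : ℂ → H} {u' : H} {w : ℂ} (hu : HasDerivAt u u' (conj w)) :
    HasDerivAt (fun z => innerSL ℂ (u (conj z))) (innerSL ℂ u') w := by
  have ht : Filter.Tendsto (fun z : ℂ => conj z) (nhds w) (nhds (conj w)) :=
    Complex.continuous_conj.tendsto w
  rw [hasDerivAt_iff_isLittleO, Asymptotics.isLittleO_iff] at hu ⊢
  intro c hc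
  filter_upwards [ht.eventually (hu hc)] with z hz
  have h : innerSL ℂ (u (conj z)) - innerSL ℂ (u (conj w)) - (z - w) • innerSL ℂ u' =
      innerSL ℂ (u (conj z) - u (conj w) - (conj z - conj w) • u') := by
    simp
  rw [h, innerSL_apply_norm]
  rwa [← RCLike.norm_conj (z - w), map_sub]

/-- A weakly holomorphic function with values in a Hilbert space is holomorphic. -/
theorem differentiableOn_of_forall_inner {H : Type*} [NormedAddCommGroup H] [InnerProductSpace ℂ H]
    [CompleteSpace H] {u : ℂ → H} {U : Set ℂ} (hU : IsOpen U)
    (hu : ∀ f : H, DifferentiableOn ℂ (fun l => inner ℂ f (u l)) U) : DifferentiableOn ℂ u U := by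
  intro a ha
  obtain ⟨R, hR, hRU⟩ := Metric.nhds_basis_closedBall.mem_iff.1 (hU.mem_nhds ha)
  -- Uniform boundedness, applied to the functionals `⟨u z, ·⟩`, makes `u` locally bounded.
  obtain ⟨C, hC⟩ : ∃ C, ∀ z ∈ Metric.closedBall a R, ‖u z‖ ≤ C := by
    obtain ⟨C, hC⟩ := banach_steinhaus (ι := Metric.closedBall a R)
      (g := fun z => innerSL ℂ (u z)) (fun f => by
        obtain ⟨C, hC⟩ := (isCompact_closedBall a R).exists_bound_of_continuousOn
          ((hu f).continuousOn.mono hRU)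
        refine ⟨C, fun z => ?_⟩
        rw [innerSL_apply_apply, norm_inner_symm]
        exact hC z z.2)
    exact ⟨C, fun z hz => by simpa using hC ⟨z, hz⟩⟩
  have hC0 : 0 ≤ C := (norm_nonneg _).trans (hC a (Metric.mem_closedBall_self hR.le))
  -- Cauchy estimates on discs of radius `R / 2` bound the derivative of `⟨f, u⟩` by a multiple of
  -- `‖f‖`; testing with `f = u z - u w` makes `u` Lipschitz, so its Cauchy integral exists.
  have hlip : ∀ z ∈ Metric.ball a (R / 2), ∀ w ∈ Metric.ball a (R / 2),
      ‖u z - u w‖ ≤ C / (R / 2) * ‖z - w‖ := by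
    intro z hz w hw
    have key : ∀ f : H, ‖(inner ℂ f (u z) : ℂ) - inner ℂ f (u w)‖ ≤
        ‖f‖ * C / (R / 2) * ‖z - w‖ := by
      intro f
      refine (convex_ball a (R / 2)).norm_image_sub_le_of_norm_deriv_le
        (f := fun l => (inner ℂ f (u l) : ℂ)) (fun x hx => ?_) (fun x hx => ?_) hw hz
      · refine (hu f).differentiableAt (hU.mem_nhds (hRU ?_))
        exact Metric.ball_subset_closedBall (Metric.ball_subset_ball (by linarith) hx)
      · have hsub : Metric.closedBall x (R / 2) ⊆ Metric.closedBall a R :=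
          Metric.closedBall_subset_closedBall' (by rw [Metric.mem_ball] at hx; linarith)
        refine Complex.norm_deriv_le_of_forall_mem_sphere_norm_le (by positivity) ?_ ?_
        · exact ((hu f).mono (hsub.trans hRU)).diffContOnCl_ball subset_rfl
        · intro y hy
          refine (norm_inner_le_norm _ _).trans ?_
          exact mul_le_mul_of_nonneg_left (hC y (hsub (Metric.sphere_subset_closedBall hy)))
            (norm_nonneg _)
    have h1 := key (u z - u w)
    rw [← inner_sub_right, inner_self_eq_norm_sq_to_K, norm_pow, RCLike.norm_ofReal, abs_norm] at h1
    rcases (norm_nonneg (u z - u w)).eq_or_lt with h2 | h2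
    · rw [← h2]; positivity
    · refine le_of_mul_le_mul_left ?_ h2
      calc _ = ‖u z - u w‖ ^ 2 := by ring
        _ ≤ _ := h1
        _ = _ := by ring
  have hcont : ContinuousOn u (Metric.ball a (R / 2)) := by
    have : LipschitzOnWith (C / (R / 2)).toNNReal u (Metric.ball a (R / 2)) :=
      LipschitzOnWith.of_dist_le_mul fun z hz w hw => by
        rw [dist_eq_norm, dist_eq_norm, Real.coe_toNNReal _ (by positivity)]
        exact hlip z hz w hw
    exact this.continuousOn
  have hcont' : ContinuousOn u (Metric.closedBall a (R / 4)) :=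
    hcont.mono (Metric.closedBall_subset_ball (by linarith))
  have hci : CircleIntegrable u a (R / 4) :=
    (hcont'.mono Metric.sphere_subset_closedBall).circleIntegrable (by positivity)
  -- The Cauchy formula is checked against each `f`, where it is the scalar one.
  have hcauchy : ∀ w ∈ Metric.ball a (R / 4),
      (2 * Real.pi * Complex.I : ℂ)⁻¹ • (∮ z in C(a, R / 4), (z - w)⁻¹ • u z) = u w := by
    intro w hw
    refine ext_inner_left ℂ fun f => ?_
    have hi : CircleIntegrable (fun z => (z - w)⁻¹ • u z) a (R / 4) := by
      refine ContinuousOn.circleIntegrable (by positivity) ?_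
      refine ContinuousOn.smul (ContinuousOn.inv₀ (by fun_prop) ?_)
        (hcont'.mono Metric.sphere_subset_closedBall)
      intro z hz h
      rw [sub_eq_zero.1 h, mem_sphere_iff_norm] at hz
      rw [mem_ball_iff_norm] at hw
      exact hw.ne hz
    have h1 : inner ℂ f (∮ z in C(a, R / 4), (z - w)⁻¹ • u z) =
        ∮ z in C(a, R / 4), (z - w)⁻¹ • inner ℂ f (u z) := by
      have := (innerSL ℂ f).intervalIntegral_comp_comm hi.out
      simp only [innerSL_apply_apply, inner_smul_right] at this
      simp only [circleIntegral, smul_eq_mul, this]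
    rw [inner_smul_right, h1]
    have h2 := Complex.two_pi_I_inv_smul_circleIntegral_sub_inv_smul_of_differentiable_on_off_countable
      (s := ∅) (f := fun z => (inner ℂ f (u z) : ℂ)) (c := a) (R := R / 4) Set.countable_empty hw
      ((hu f).continuousOn.mono ((Metric.closedBall_subset_closedBall (by linarith)).trans hRU))
      (fun x hx => (hu f).differentiableAt (hU.mem_nhds (hRU
        (Metric.ball_subset_closedBall (Metric.ball_subset_ball (by linarith) hx.1)))))
    simpa using h2
  have han := (hasFPowerSeriesOn_cauchy_integral (R := ⟨R / 4, by positivity⟩) hci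
    (show (0 : ℝ) < R / 4 by positivity)).analyticAt.differentiableAt
  refine (han.congr_of_eventuallyEq ?_).differentiableWithinAt
  filter_upwards [Metric.ball_mem_nhds a (show (0 : ℝ) < R / 4 by positivity)] with w hw
  exact (hcauchy w hw).symm

/-! ### Calculus of matrix-valued functions -/

section MatrixCalculus
open scoped Matrix.Norms.Operator

theorem Matrix.eq_sum_smul_single {n : ℕ} (A : Matrix (Fin n) (Fin n) ℂ) :
    A = ∑ i, ∑ j, A i j • Matrix.single i j (1 : ℂ) := by
  conv_lhs => rw [Matrix.matrix_eq_sum_single A]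
  simp [Matrix.smul_single]

theorem Matrix.differentiableAt_of_entries {n : ℕ} {E : Type*} [NormedAddCommGroup E]
    [NormedSpace ℂ E] {f : E → Matrix (Fin n) (Fin n) ℂ} {x : E}
    (hf : ∀ i j, DifferentiableAt ℂ (fun z => f z i j) x) : DifferentiableAt ℂ f x := by
  rw [show f = fun z => ∑ i, ∑ j, f z i j • Matrix.single i j (1 : ℂ) from
    funext fun z => Matrix.eq_sum_smul_single (f z)]
  fun_prop

theorem Matrix.hasDerivAt_of_entries {n : ℕ} {f : ℂ → Matrix (Fin n) (Fin n) ℂ} {x : ℂ}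
    {f' : Matrix (Fin n) (Fin n) ℂ}
    (hf : ∀ i j, HasDerivAt (fun z => f z i j) (f' i j) x) : HasDerivAt f f' x := by
  rw [show f = fun z => ∑ i, ∑ j, f z i j • Matrix.single i j (1 : ℂ) from
    funext fun z => Matrix.eq_sum_smul_single (f z), Matrix.eq_sum_smul_single f']
  exact HasDerivAt.fun_sum fun i _ => HasDerivAt.fun_sum fun j _ => (hf i j).smul_const _

theorem Matrix.differentiableAt_inv {n : ℕ} {E : Type*} [NormedAddCommGroup E]
    [NormedSpace ℂ E] {f : E → Matrix (Fin n) (Fin n) ℂ} {x : E}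
    (hf : DifferentiableAt ℂ f x) (hx : IsUnit (f x)) : DifferentiableAt ℂ (fun z => (f z)⁻¹) x := by
  simp only [Matrix.nonsing_inv_eq_ringInverse]
  exact (differentiableAt_inverse hx).comp x hf

theorem Matrix.differentiableAt_entry {n : ℕ} {E : Type*} [NormedAddCommGroup E]
    [NormedSpace ℂ E] {f : E → Matrix (Fin n) (Fin n) ℂ} {x : E}
    (hf : DifferentiableAt ℂ f x) (i j : Fin n) : DifferentiableAt ℂ (fun z => f z i j) x :=
  (LinearMap.toContinuousLinearMap (Matrix.entryLinearMap ℂ ℂ i j)).differentiableAt.comp x hf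

/-- Two solutions of the same linear equation `X' = X Ξ` differ by a constant left factor. -/
theorem Matrix.eq_mul_of_hasDerivAt {n : ℕ} {V : Set ℂ} (hV : IsOpen V) (hc : Convex ℝ V)
    {a : ℂ} (ha : a ∈ V) {X Y Ξ : ℂ → Matrix (Fin n) (Fin n) ℂ}
    (hX : ∀ z ∈ V, HasDerivAt X (X z * Ξ z) z) (hY : ∀ z ∈ V, HasDerivAt Y (Y z * Ξ z) z)
    (hYu : ∀ z ∈ V, IsUnit (Y z)) : ∀ z ∈ V, X z = X a * (Y a)⁻¹ * Y z := by
  -- Since `(Y⁻¹)' = -Ξ Y⁻¹`, the two terms of `(X Y⁻¹)'` cancel.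
  have hd : ∀ z ∈ V, HasDerivAt (fun z => X z * (Y z)⁻¹) 0 z := by
    intro z hz
    obtain ⟨y, hy⟩ := hYu z hz
    have h1 : HasDerivAt (fun z => (Y z)⁻¹) (-(Ξ z * (Y z)⁻¹)) z := by
      simp only [Matrix.nonsing_inv_eq_ringInverse]
      have h2 := hasFDerivAt_ringInverse (𝕜 := ℂ) y
      rw [hy] at h2
      refine (h2.comp_hasDerivAt z (hY z hz)).congr_deriv ?_
      simp only [← hy, Ring.inverse_unit]
      simp
    refine ((hX z hz).mul h1).congr_deriv ?_
    simp [mul_assoc]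
  intro z hz
  have h := hV.is_const_of_deriv_eq_zero hc.isPreconnected
    (fun x hx => (hd x hx).differentiableAt.differentiableWithinAt) (fun x hx => (hd x hx).deriv) hz ha
  have := congrArg (· * Y z) h
  simpa [mul_assoc, Matrix.nonsing_inv_mul _ ((Matrix.isUnit_iff_isUnit_det _).1 (hYu z hz))] using this

end MatrixCalculus

/-! ### Gram matrices, changes of frame and the connection -/

section Gram
variable {n : ℕ} {H : Type*} [NormedAddCommGroup H] [InnerProductSpace ℂ H]

/-- The matrix of inner products of the vectors of two families. -/
def crossGram (u v : Fin n → H) : Matrix (Fin n) (Fin n) ℂ := Matrix.of fun i j => inner ℂ (u i) (v j)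

/-- The family `u M`, where `u` is regarded as a row of vectors. -/
def changeFrame (u : Fin n → H) (M : Matrix (Fin n) (Fin n) ℂ) : Fin n → H :=
  fun j => ∑ i, M i j • u i

open scoped Matrix

theorem crossGram_conjTranspose (u v : Fin n → H) : (crossGram u v)ᴴ = crossGram v u := by
  ext i j; simp [crossGram, Matrix.conjTranspose_apply]

theorem crossGram_changeFrame_right (u v : Fin n → H) (M : Matrix (Fin n) (Fin n) ℂ) :
    crossGram u (changeFrame v M) = crossGram u v * M := by
  ext i j
  simp [crossGram, changeFrame, Matrix.mul_apply, mul_comm]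

theorem crossGram_changeFrame_left (u v : Fin n → H) (M : Matrix (Fin n) (Fin n) ℂ) :
    crossGram (changeFrame u M) v = Mᴴ * crossGram u v := by
  rw [← crossGram_conjTranspose, crossGram_changeFrame_right, Matrix.conjTranspose_mul,
    crossGram_conjTranspose]

theorem crossGram_add_right (u v w : Fin n → H) :
    crossGram u (v + w) = crossGram u v + crossGram u w := by
  ext i j; simp [crossGram]

theorem crossGram_map {H' : Type*} [NormedAddCommGroup H'] [InnerProductSpace ℂ H']
    (U : H ≃ₗᵢ[ℂ] H') (u v : Fin n → H) :
    crossGram (fun i => U (u i)) (fun i => U (v i)) = crossGram u v := by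
  ext i j; simp [crossGram]

theorem changeFrame_one (u : Fin n → H) : changeFrame u 1 = u := by
  ext j; simp [changeFrame, Matrix.one_apply]

theorem changeFrame_changeFrame (u : Fin n → H) (M N : Matrix (Fin n) (Fin n) ℂ) :
    changeFrame (changeFrame u M) N = changeFrame u (M * N) := by
  ext j
  simp only [changeFrame, Matrix.mul_apply, Finset.smul_sum, Finset.sum_smul, smul_smul]
  rw [Finset.sum_comm]
  simp only [mul_comm]

open scoped ComplexOrder in
theorem posDef_crossGram {u : Fin n → H} (hu : LinearIndependent ℂ u) : (crossGram u u).PosDef :=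
  Matrix.posDef_gram_of_linearIndependent hu

/-- The first slot is conjugate-linear, so `u` enters antiholomorphically and `∂` annihilates its
contribution. -/
theorem wirtinger_inner {u v : ℂ → H} {l : ℂ} (hu : DifferentiableAt ℂ u l)
    (hv : DifferentiableAt ℂ v l) :
    wirtinger (fun z => inner ℂ (u z) (v z)) l = inner ℂ (u l) (deriv v l) := by
  have hu' := hu.hasDerivAt.hasFDerivAt.restrictScalars ℝ
  have hv' := hv.hasDerivAt.hasFDerivAt.restrictScalars ℝ
  have h := hu'.inner ℂ hv'
  rw [wirtinger, h.fderiv]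
  simp [inner_smul_left, inner_smul_right]
  linear_combination (-(inner ℂ (u l) (deriv v l) : ℂ) / 2 + inner ℂ (deriv u l) (v l) / 2) * Complex.I_sq

theorem connectionMatrix_gramMetric {γ : Fin n → ℂ → H} {l : ℂ}
    (hγ : ∀ i, DifferentiableAt ℂ (γ i) l) :
    connectionMatrix (gramMetric γ) l = (crossGram (fun i => γ i l) fun i => γ i l)⁻¹ *
      crossGram (fun i => γ i l) fun i => deriv (γ i) l := by
  have : (Matrix.of fun i j => wirtinger (fun z => gramMetric γ z i j) l) =
      crossGram (fun i => γ i l) fun i => deriv (γ i) l := by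
    ext i j
    exact wirtinger_inner (hγ i) (hγ j)
  rw [connectionMatrix, this]
  rfl

/-- Conjugating the argument in the conjugate-linear slot makes the polarized metric jointly
holomorphic. -/
theorem differentiableAt_crossGram_entry {γ δ : Fin n → ℂ → H} {p : ℂ × ℂ}
    (hγ : ∀ i, DifferentiableAt ℂ (γ i) (conj p.2)) (hδ : ∀ i, DifferentiableAt ℂ (δ i) p.1)
    (i j : Fin n) :
    DifferentiableAt ℂ
      (fun p : ℂ × ℂ => crossGram (fun i => γ i (conj p.2)) (fun i => δ i p.1) i j) p := by
  have h1 : DifferentiableAt ℂ (fun p : ℂ × ℂ => innerSL ℂ (γ i (conj p.2))) p :=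
    DifferentiableAt.comp p (f := fun p : ℂ × ℂ => p.2)
      (hasDerivAt_innerSL_conj (hγ i).hasDerivAt).differentiableAt differentiableAt_snd
  have h2 : DifferentiableAt ℂ (fun p : ℂ × ℂ => δ j p.1) p :=
    DifferentiableAt.comp p (f := fun p : ℂ × ℂ => p.1) (hδ j) differentiableAt_fst
  exact h1.clm_apply h2

theorem hasDerivAt_crossGram_entry {δ : Fin n → ℂ → H} (u : Fin n → H) {z : ℂ}
    (hδ : ∀ i, DifferentiableAt ℂ (δ i) z) (i j : Fin n) :
    HasDerivAt (fun z => crossGram u (fun i => δ i z) i j)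
      (crossGram u (fun i => deriv (δ i) z) i j) z :=
  (innerSL ℂ (u i)).hasFDerivAt.comp_hasDerivAt z (hδ j).hasDerivAt

end Gram

/-! ### Holomorphic frames of Cowen-Douglas bundles -/

/-- If `f` is orthogonal to `p`, the holomorphic functions `⟨f, γ i⟩` vanish on `V`, hence on the
connected set `Ω`; so `f` is orthogonal to every eigenspace and is zero. -/
theorem dense_span_of_isHolomorphicFrame {n : ℕ} {H : Type*} [NormedAddCommGroup H]
    [InnerProductSpace ℂ H] [CompleteSpace H] {Ω : Set ℂ} (hΩ : IsOpen Ω) (hΩc : IsConnected Ω)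
    {T : H →L[ℂ] H} (hT : CowenDouglas n Ω T) {γ : Fin n → ℂ → H} (hγ : IsHolomorphicFrame T Ω γ)
    {V : Set ℂ} (hV : IsOpen V) (hVΩ : V ⊆ Ω) (hVn : V.Nonempty) {p : Submodule ℂ H}
    (hp : ∀ z ∈ V, ∀ i, γ i z ∈ p) : p.topologicalClosure = ⊤ := by
  rw [Submodule.topologicalClosure_eq_top_iff, Submodule.eq_bot_iff]
  intro f hf
  obtain ⟨a, ha⟩ := hVn
  have h0 : ∀ i, ∀ z ∈ Ω, inner ℂ f (γ i z) = 0 := by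
    intro i
    have hd : DifferentiableOn ℂ (fun z => (inner ℂ f (γ i z) : ℂ)) Ω :=
      (innerSL ℂ f).differentiable.comp_differentiableOn (hγ.differentiableOn i)
    refine (hd.analyticOnNhd hΩ).eqOn_zero_of_preconnected_of_eventuallyEq_zero
      hΩc.isPreconnected (hVΩ ha) ?_
    filter_upwards [hV.mem_nhds ha] with z hz
    exact Submodule.inner_left_of_mem_orthogonal (hp z hz i) hf
  have h1 : (⨆ l ∈ Ω, Module.End.eigenspace (T : H →ₗ[ℂ] H) l) ≤ (Submodule.span ℂ {f})ᗮ := by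
    refine iSup₂_le fun l hl => ?_
    rw [← hγ.span_eq l hl, Submodule.span_le]
    rintro _ ⟨i, rfl⟩
    rw [SetLike.mem_coe, Submodule.mem_orthogonal_singleton_iff_inner_right]
    exact h0 i l hl
  have h2 := Submodule.topologicalClosure_minimal _ h1 (Submodule.isClosed_orthogonal _)
  rw [hT.dense_span] at h2
  have h3 := h2 (Submodule.mem_top (x := f))
  rw [Submodule.mem_orthogonal_singleton_iff_inner_right] at h3
  exact inner_self_eq_zero.1 h3

section Frames
open scoped Matrix.Norms.Operator Matrix

/-- Independence is invertibility of the Gram matrix `K(conj l, conj l)`; the reproducing property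
gives weak holomorphy and the eigenvector equation; the span is the whole eigenspace by dimension.
-/
theorem isHolomorphicFrame_kernelFrame {n : ℕ} {Ω : Set ℂ} (hΩ : IsOpen Ω) {H : Type*}
    [NormedAddCommGroup H] [InnerProductSpace ℂ H] [CompleteSpace H]
    [RKHS ℂ H (conjDomain Ω) (EuclideanSpace ℂ (Fin n))] {T : H →L[ℂ] H}
    (hT : CowenDouglas n Ω T) (hK : IsKernelRealization T) :
    IsHolomorphicFrame T Ω (kernelFrame (n := n) (Ω := Ω) H) := by
  have hmem : ∀ l ∈ Ω, conj l ∈ conjDomain Ω := fun l hl => by simpa [conjDomain] using hl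
  have hconj : ∀ w ∈ conjDomain Ω, conj w ∈ Ω := fun w hw => hw
  have hΩ' : IsOpen (conjDomain Ω) := hΩ.preimage Complex.continuous_conj
  have hli : ∀ l ∈ Ω, LinearIndependent ℂ fun i => kernelFrame (n := n) (Ω := Ω) H i l := by
    intro l hl
    refine Matrix.linearIndependent_of_det_gram_ne_zero (𝕜 := ℂ) ?_
    have h := gramMetric_kernelFrame (n := n) (Ω := Ω) H l (hmem l hl)
    have h2 := hK.isUnit_kernel ⟨conj l, hmem l hl⟩
    rw [← h, Matrix.isUnit_iff_isUnit_det] at h2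
    exact h2.ne_zero
  refine ⟨fun j => ?_, hli, fun l hl => ?_⟩
  · refine differentiableOn_of_forall_inner hΩ fun f => ?_
    obtain ⟨F, hF, hFf⟩ := hK.holomorphic f
    intro l hl
    have h1 : DifferentiableAt ℂ (fun z => F z j) (conj l) :=
      ((EuclideanSpace.proj j : EuclideanSpace ℂ (Fin n) →L[ℂ] ℂ).differentiableAt).comp _
        (hF.differentiableAt (hΩ'.mem_nhds (hmem l hl)))
    have h2 := h1.conj_conj
    rw [Complex.conj_conj] at h2
    refine (h2.congr_of_eventuallyEq ?_).differentiableWithinAt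
    filter_upwards [hΩ.mem_nhds hl] with z hz
    rw [kernelFrame, dif_pos (hmem z hz), RKHS.inner_kerFun, ← hFf,
      EuclideanSpace.inner_single_right]
    simp
  · have hle : Submodule.span ℂ (Set.range fun i => kernelFrame (n := n) (Ω := Ω) H i l) ≤
        Module.End.eigenspace (T : H →ₗ[ℂ] H) l := by
      rw [Submodule.span_le]
      rintro _ ⟨j, rfl⟩
      rw [SetLike.mem_coe, Module.End.mem_eigenspace_iff]
      refine ext_inner_right ℂ fun f => ?_
      rw [ContinuousLinearMap.coe_coe, ← ContinuousLinearMap.adjoint_inner_right]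
      simp only [kernelFrame, dif_pos (hmem l hl), RKHS.kerFun_inner, hK.adjoint_apply,
        inner_smul_left, inner_smul_right]
    have hfin : FiniteDimensional ℂ (Module.End.eigenspace (T : H →ₗ[ℂ] H) l) := by
      refine Module.finite_of_rank_eq_nat (hT.rank_ker l hl)
    refine Submodule.eq_of_le_of_finrank_eq hle ?_
    rw [finrank_span_eq_card (hli l hl), Fintype.card_fin,
      Module.finrank_eq_of_rank_eq (hT.rank_ker l hl)]

/-! ### Unitary equivalence and gauge equivalence -/

section Equivalence
variable {n : ℕ} {Ω : Set ℂ} {HT HS : Type*}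
  [NormedAddCommGroup HT] [InnerProductSpace ℂ HT]
  [NormedAddCommGroup HS] [InnerProductSpace ℂ HS] {T : HT →L[ℂ] HT} {S : HS →L[ℂ] HS}
  {γT : Fin n → ℂ → HT} {γS : Fin n → ℂ → HS}

open scoped ComplexOrder in
/-- An intertwining unitary is given by an invertible matrix on each fibre. -/
theorem exists_changeFrame_of_intertwining (hγT : IsHolomorphicFrame T Ω γT)
    (hγS : IsHolomorphicFrame S Ω γS) (U : HT ≃ₗᵢ[ℂ] HS) (hU : ∀ x, U (T x) = S (U x))
    {l : ℂ} (hl : l ∈ Ω) :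
    ∃ M : Matrix (Fin n) (Fin n) ℂ, IsUnit M ∧
      (fun j => U (γT j l)) = changeFrame (fun i => γS i l) M := by
  have h1 : ∀ j, ∃ c : Fin n → ℂ, ∑ i, c i • γS i l = U (γT j l) := by
    intro j
    rw [← Submodule.mem_span_range_iff_exists_fun, hγS.span_eq l hl, Module.End.mem_eigenspace_iff]
    have h2 : γT j l ∈ Module.End.eigenspace (T : HT →ₗ[ℂ] HT) l := by
      rw [← hγT.span_eq l hl]
      exact Submodule.subset_span ⟨j, rfl⟩
    rw [Module.End.mem_eigenspace_iff, ContinuousLinearMap.coe_coe] at h2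
    rw [ContinuousLinearMap.coe_coe, ← hU, h2, map_smul]
  choose c hc using h1
  refine ⟨Matrix.of fun i j => c j i, ?_, ?_⟩
  swap
  · ext j; exact (hc j).symm
  set M : Matrix (Fin n) (Fin n) ℂ := Matrix.of fun i j => c j i
  have hM : (fun j => U (γT j l)) = changeFrame (fun i => γS i l) M := by
    ext j; exact (hc j).symm
  -- Transported by `U`, the invertible Gram matrix of `γT` acquires `M` as a right factor.
  have h3 := (posDef_crossGram (hγT.linearIndependent l hl)).isUnit
  rw [← crossGram_map U, hM, crossGram_changeFrame_right, Matrix.isUnit_iff_isUnit_det,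
    Matrix.det_mul] at h3
  exact (Matrix.isUnit_iff_isUnit_det _).2 (isUnit_of_mul_isUnit_right h3)

open scoped ComplexOrder in
theorem gaugeEquivalent_of_unitarilyEquivalent (hΩ : IsOpen Ω) (hΩn : Ω.Nonempty)
    (hγT : IsHolomorphicFrame T Ω γT) (hγS : IsHolomorphicFrame S Ω γS)
    (h : UnitarilyEquivalent T S) :
    HolomorphicGaugeEquivalent Ω (connectionMatrix (gramMetric γT))
      (connectionMatrix (gramMetric γS)) := by
  obtain ⟨U, hU⟩ := h
  obtain ⟨a, ha⟩ := hΩn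
  have hdT : ∀ z ∈ Ω, ∀ i, DifferentiableAt ℂ (γT i) z := fun z hz i =>
    (hγT.differentiableOn i).differentiableAt (hΩ.mem_nhds hz)
  have hdS : ∀ z ∈ Ω, ∀ i, DifferentiableAt ℂ (γS i) z := fun z hz i =>
    (hγS.differentiableOn i).differentiableAt (hΩ.mem_nhds hz)
  have hdU : ∀ z ∈ Ω, ∀ i, HasDerivAt (fun z => U (γT i z)) (U (deriv (γT i) z)) z :=
    fun z hz i => (U.toContinuousLinearEquiv : HT →L[ℂ] HS).hasFDerivAt.comp_hasDerivAt z
      (hdT z hz i).hasDerivAt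
  -- Pairing `U γT = γS Φ` with the fixed vectors `γS i a` gives `F = G Φ`, so `Φ = G⁻¹ F` is
  -- holomorphic where `G` is invertible, in particular near `a`.
  set G : ℂ → Matrix (Fin n) (Fin n) ℂ :=
    fun z => crossGram (fun i => γS i a) (fun i => γS i z) with hG
  set F : ℂ → Matrix (Fin n) (Fin n) ℂ :=
    fun z => crossGram (fun i => γS i a) (fun i => U (γT i z)) with hF
  have hdG : ∀ z ∈ Ω, DifferentiableAt ℂ G z := fun z hz =>
    (Matrix.hasDerivAt_of_entries (hasDerivAt_crossGram_entry _ (hdS z hz))).differentiableAt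
  have hdF : ∀ z ∈ Ω, DifferentiableAt ℂ F z := fun z hz =>
    (Matrix.hasDerivAt_of_entries (hasDerivAt_crossGram_entry (δ := fun i z => U (γT i z)) _
      (fun i => (hdU z hz i).differentiableAt))).differentiableAt
  set V := Ω ∩ G ⁻¹' {x | IsUnit x}
  have hVo : IsOpen V := ContinuousOn.isOpen_inter_preimage
    (fun z hz => (hdG z hz).continuousAt.continuousWithinAt) hΩ Units.isOpen
  have hdΦ : ∀ z ∈ V, DifferentiableAt ℂ (fun z => (G z)⁻¹ * F z) z := fun z hz =>
    (Matrix.differentiableAt_inv (hdG z hz.1) hz.2).mul (hdF z hz.1)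
  have hΦ : ∀ z ∈ V, IsUnit ((G z)⁻¹ * F z) ∧
      (fun j => U (γT j z)) = changeFrame (fun i => γS i z) ((G z)⁻¹ * F z) := by
    intro z hz
    obtain ⟨M, hMu, hM⟩ := exists_changeFrame_of_intertwining hγT hγS U hU hz.1
    have : (G z)⁻¹ * F z = M := by
      simp only [hF, hM, crossGram_changeFrame_right]
      exact Matrix.nonsing_inv_mul_cancel_left _ _ ((Matrix.isUnit_iff_isUnit_det _).1 hz.2)
    rw [this]
    exact ⟨hMu, hM⟩
  refine ⟨V, Set.inter_subset_left, hVo, ⟨a, ha, ?_⟩, fun z => (G z)⁻¹ * F z,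
    fun i j z hz => (Matrix.differentiableAt_entry (hdΦ z hz) i j).differentiableWithinAt,
    fun z hz => (hΦ z hz).1, fun z hz => ?_⟩
  · exact (posDef_crossGram (hγS.linearIndependent a ha)).isUnit
  rw [connectionMatrix_gramMetric (hdT z hz.1), connectionMatrix_gramMetric (hdS z hz.1)]
  obtain ⟨hΦu, hΦe⟩ := hΦ z hz
  -- Product rule: `U γT' = γS' Φ + γS Φ'`.
  have hd : (fun j => U (deriv (γT j) z)) =
      changeFrame (fun i => deriv (γS i) z) ((G z)⁻¹ * F z) + changeFrame (fun i => γS i z)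
        (Matrix.of fun i j => deriv (fun z => ((G z)⁻¹ * F z) i j) z) := by
    ext j
    rw [← (hdU z hz.1 j).deriv]
    have h1 : (fun z => U (γT j z)) =ᶠ[nhds z]
        fun z => ∑ i, ((G z)⁻¹ * F z) i j • γS i z := by
      filter_upwards [hVo.mem_nhds hz] with w hw
      exact congrFun (hΦ w hw).2 j
    rw [h1.deriv_eq]
    have h2 : HasDerivAt (fun z => ∑ i, ((G z)⁻¹ * F z) i j • γS i z) _ z :=
      HasDerivAt.fun_sum fun i _ => (Matrix.differentiableAt_entry (hdΦ z hz) i j).hasDerivAt.smul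
        (hdS z hz.1 i).hasDerivAt
    rw [h2.deriv, Finset.sum_add_distrib]
    rfl
  have hSu := (Matrix.isUnit_iff_isUnit_det _).1
    (posDef_crossGram (hγS.linearIndependent z hz.1)).isUnit
  rw [← crossGram_map U, ← crossGram_map U, hd, hΦe, crossGram_changeFrame_left, crossGram_changeFrame_right,
    crossGram_changeFrame_left, crossGram_add_right, crossGram_changeFrame_right,
    crossGram_changeFrame_right]
  have hΦh : IsUnit ((G z)⁻¹ * F z)ᴴ.det := by
    rw [Matrix.det_conjTranspose]; exact ((Matrix.isUnit_iff_isUnit_det _).1 hΦu).star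
  beta_reduce
  generalize (G z)⁻¹ * F z = Φ at hΦh ⊢
  rw [Matrix.mul_inv_rev, Matrix.mul_inv_rev, mul_assoc, Matrix.nonsing_inv_mul_cancel_left _ _ hΦh, mul_assoc,
    mul_add, Matrix.nonsing_inv_mul_cancel_left _ _ hSu, mul_add]
  simp only [mul_assoc]

open scoped ComplexOrder in
theorem unitarilyEquivalent_of_gaugeEquivalent [CompleteSpace HT] [CompleteSpace HS]
    (hΩ : IsOpen Ω) (hΩc : IsConnected Ω)
    (hT : CowenDouglas n Ω T) (hS : CowenDouglas n Ω S)
    (hγT : IsHolomorphicFrame T Ω γT) (hγS : IsHolomorphicFrame S Ω γS)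
    (h : HolomorphicGaugeEquivalent Ω (connectionMatrix (gramMetric γT))
      (connectionMatrix (gramMetric γS))) :
    UnitarilyEquivalent T S := by
  obtain ⟨U, hUΩ, hU, ⟨a, ha⟩, Φ, hΦd, hΦu, hΘ⟩ := h
  have hdT : ∀ z ∈ U, ∀ i, DifferentiableAt ℂ (γT i) z := fun z hz i =>
    (hγT.differentiableOn i).differentiableAt (hΩ.mem_nhds (hUΩ hz))
  have hdS : ∀ z ∈ U, ∀ i, DifferentiableAt ℂ (γS i) z := fun z hz i =>
    (hγS.differentiableOn i).differentiableAt (hΩ.mem_nhds (hUΩ hz))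
  have hdT' : ∀ z ∈ U, ∀ i, DifferentiableAt ℂ (deriv (γT i)) z := fun z hz i =>
    ((hγT.differentiableOn i).deriv hΩ).differentiableAt (hΩ.mem_nhds (hUΩ hz))
  have hdS' : ∀ z ∈ U, ∀ i, DifferentiableAt ℂ (deriv (γS i)) z := fun z hz i =>
    ((hγS.differentiableOn i).deriv hΩ).differentiableAt (hΩ.mem_nhds (hUΩ hz))
  set Φ' : ℂ → Matrix (Fin n) (Fin n) ℂ := fun z => Matrix.of fun i j => deriv (fun z => Φ z i j) z
  have hdΦ : ∀ z ∈ U, HasDerivAt Φ (Φ' z) z := fun z hz =>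
    Matrix.hasDerivAt_of_entries fun i j => ((hΦd i j).differentiableAt (hU.mem_nhds hz)).hasDerivAt
  have hdΦ' : ∀ z ∈ U, DifferentiableAt ℂ Φ' z := fun z hz =>
    Matrix.differentiableAt_of_entries fun i j =>
      ((hΦd i j).deriv hU).differentiableAt (hU.mem_nhds hz)
  set KT : ℂ × ℂ → Matrix (Fin n) (Fin n) ℂ :=
    fun p => crossGram (fun i => γT i (conj p.2)) (fun i => γT i p.1)
  set KS : ℂ × ℂ → Matrix (Fin n) (Fin n) ℂ :=
    fun p => crossGram (fun i => γS i (conj p.2)) (fun i => γS i p.1)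
  set kT : ℂ × ℂ → Matrix (Fin n) (Fin n) ℂ :=
    fun p => crossGram (fun i => γT i (conj p.2)) (fun i => deriv (γT i) p.1)
  set kS : ℂ × ℂ → Matrix (Fin n) (Fin n) ℂ :=
    fun p => crossGram (fun i => γS i (conj p.2)) (fun i => deriv (γS i) p.1)
  have hKT : ∀ p : ℂ × ℂ, p.1 ∈ U → conj p.2 ∈ U → DifferentiableAt ℂ KT p := fun p h1 h2 =>
    Matrix.differentiableAt_of_entries (differentiableAt_crossGram_entry (hdT _ h2) (hdT _ h1))
  have hKS : ∀ p : ℂ × ℂ, p.1 ∈ U → conj p.2 ∈ U → DifferentiableAt ℂ KS p := fun p h1 h2 =>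
    Matrix.differentiableAt_of_entries (differentiableAt_crossGram_entry (hdS _ h2) (hdS _ h1))
  have hkT : ∀ p : ℂ × ℂ, p.1 ∈ U → conj p.2 ∈ U → DifferentiableAt ℂ kT p := fun p h1 h2 =>
    Matrix.differentiableAt_of_entries
      (differentiableAt_crossGram_entry (δ := fun i => deriv (γT i)) (hdT _ h2) (hdT' _ h1))
  have hkS : ∀ p : ℂ × ℂ, p.1 ∈ U → conj p.2 ∈ U → DifferentiableAt ℂ kS p := fun p h1 h2 =>
    Matrix.differentiableAt_of_entries
      (differentiableAt_crossGram_entry (δ := fun i => deriv (γS i)) (hdS _ h2) (hdS' _ h1))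
  have hpT : ∀ z ∈ U, (KT (z, conj z)).PosDef := fun z hz => by
    simpa [KT] using posDef_crossGram (hγT.linearIndependent z (hUΩ hz))
  have hpS : ∀ z ∈ U, (KS (z, conj z)).PosDef := fun z hz => by
    simpa [KS] using posDef_crossGram (hγS.linearIndependent z (hUΩ hz))
  -- Positivity gives invertibility only on `w = conj z`; continuity extends it to a bidisc around
  -- `(a, conj a)`.
  obtain ⟨r, hr, hball⟩ : ∃ r > 0, ∀ p ∈ Metric.ball a r ×ˢ Metric.ball (conj a) r,
      p.1 ∈ U ∧ conj p.2 ∈ U ∧ IsUnit (KT p) ∧ IsUnit (KS p) := by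
    have hca : conj (a, conj a).2 ∈ U := by simpa using ha
    have h1 : ∀ᶠ p in nhds (a, conj a),
        p.1 ∈ U ∧ conj p.2 ∈ U ∧ IsUnit (KT p) ∧ IsUnit (KS p) := by
      filter_upwards [(continuous_fst (X := ℂ) (Y := ℂ)).continuousAt.preimage_mem_nhds
          (x := (a, conj a)) (hU.mem_nhds ha),
        (Complex.continuous_conj.comp (continuous_snd (X := ℂ))).continuousAt.preimage_mem_nhds
          (x := (a, conj a)) (hU.mem_nhds hca),
        (hKT _ ha hca).continuousAt.preimage_mem_nhds (Units.isOpen.mem_nhds (hpT a ha).isUnit),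
        (hKS _ ha hca).continuousAt.preimage_mem_nhds (Units.isOpen.mem_nhds (hpS a ha).isUnit)]
        with p h1 h2 h3 h4 using ⟨h1, h2, h3, h4⟩
    obtain ⟨r, hr, h2⟩ := Metric.eventually_nhds_iff_ball.1 h1
    exact ⟨r, hr, fun p hp => h2 p (by rwa [← ball_prod_same])⟩
  have hE : ∀ z ∈ Metric.ball a (r / 2), ∀ w ∈ Metric.ball (conj a) (r / 2),
      (KT (z, w))⁻¹ * kT (z, w) - ((Φ z)⁻¹ * ((KS (z, w))⁻¹ * kS (z, w)) * Φ z +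
        (Φ z)⁻¹ * Φ' z) = 0 := by
    refine eq_zero_of_eq_zero_conj (G := fun p => (KT p)⁻¹ * kT p -
      ((Φ p.1)⁻¹ * ((KS p)⁻¹ * kS p) * Φ p.1 + (Φ p.1)⁻¹ * Φ' p.1)) ?_ ?_
    · intro p hp
      obtain ⟨h1, h2, h3, h4⟩ := hball p hp
      have hd1 : DifferentiableAt ℂ (fun p : ℂ × ℂ => Φ p.1) p :=
        DifferentiableAt.comp p (f := fun p : ℂ × ℂ => p.1) (hdΦ _ h1).differentiableAt
          differentiableAt_fst
      have hd2 : DifferentiableAt ℂ (fun p : ℂ × ℂ => Φ' p.1) p :=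
        DifferentiableAt.comp p (f := fun p : ℂ × ℂ => p.1) (hdΦ' _ h1) differentiableAt_fst
      have hd3 := Matrix.differentiableAt_inv hd1 (hΦu _ h1)
      have hd4 := (Matrix.differentiableAt_inv (hKS p h1 h2) h4).mul (hkS p h1 h2)
      have hd5 := (Matrix.differentiableAt_inv (hKT p h1 h2) h3).mul (hkT p h1 h2)
      exact (hd5.sub (((hd3.mul hd4).mul hd1).add (hd3.mul hd2))).differentiableWithinAt
    · intro z hz
      have hzU : z ∈ U := (hball (z, conj a) ⟨hz, Metric.mem_ball_self hr⟩).1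
      have := hΘ z hzU
      rw [connectionMatrix_gramMetric (hdT z hzU), connectionMatrix_gramMetric (hdS z hzU)] at this
      simp only [KT, KS, kT, kS, Complex.conj_conj]
      rw [this, sub_self]
  set V := Metric.ball a (r / 2) with hV
  have haV : a ∈ V := Metric.mem_ball_self (by positivity)
  have hVc : ∀ w ∈ V, conj w ∈ Metric.ball (conj a) (r / 2) := fun w hw => by
    rw [mem_ball_iff_norm] at hw ⊢
    rwa [← map_sub, RCLike.norm_conj]
  have hVb : ∀ z ∈ V, ∀ w ∈ V, (z, conj w) ∈ Metric.ball a r ×ˢ Metric.ball (conj a) r :=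
    fun z hz w hw => ⟨Metric.ball_subset_ball (by linarith) hz,
      Metric.ball_subset_ball (by linarith) (hVc w hw)⟩
  have hVU : V ⊆ U := fun z hz => (hball _ (hVb z hz a haV)).1
  -- Both sides solve `X' = X Ξ` in `z`, with `Ξ` the polarized connection of `T`; by `hE` this is
  -- also the equation of `KS Φ`.
  have hmul : ∀ w ∈ V, ∀ z ∈ V, KT (z, conj w) =
      KT (a, conj w) * (KS (a, conj w) * Φ a)⁻¹ * (KS (z, conj w) * Φ z) := by
    intro w hw
    refine Matrix.eq_mul_of_hasDerivAt (V := V) Metric.isOpen_ball (convex_ball _ _) haV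
      (X := fun z => KT (z, conj w)) (Y := fun z => KS (z, conj w) * Φ z)
      (Ξ := fun z => (KT (z, conj w))⁻¹ * kT (z, conj w)) (fun z hz => ?_) (fun z hz => ?_)
      (fun z hz => (hball _ (hVb z hz w hw)).2.2.2.mul (hΦu z (hVU hz)))
    · rw [Matrix.mul_nonsing_inv_cancel_left _ _
        ((Matrix.isUnit_iff_isUnit_det _).1 (hball _ (hVb z hz w hw)).2.2.1)]
      exact Matrix.hasDerivAt_of_entries 
          (hasDerivAt_crossGram_entry (fun i => γT i (conj (conj w))) (hdT z (hVU hz)))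
    · have h1 : HasDerivAt (fun z => KS (z, conj w)) (kS (z, conj w)) z :=
        Matrix.hasDerivAt_of_entries 
          (hasDerivAt_crossGram_entry (fun i => γS i (conj (conj w))) (hdS z (hVU hz)))
      refine (h1.mul (hdΦ z (hVU hz))).congr_deriv ?_
      rw [sub_eq_zero.1 (hE z hz _ (hVc w hw)), mul_add]
      have h2 := (Matrix.isUnit_iff_isUnit_det _).1 (hΦu z (hVU hz))
      have h3 := (Matrix.isUnit_iff_isUnit_det _).1 (hball _ (hVb z hz w hw)).2.2.2
      simp only [mul_assoc, Matrix.mul_nonsing_inv_cancel_left _ _ h2,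
        Matrix.mul_nonsing_inv_cancel_left _ _ h3]
  have hΦh : ∀ w ∈ V, IsUnit (Φ w)ᴴ.det := fun w hw => by
    rw [Matrix.det_conjTranspose]
    exact ((Matrix.isUnit_iff_isUnit_det _).1 (hΦu w (hVU hw))).star
  -- The factor `(Φ w)ᴴ` makes the second kernel Hermitian; its inverse is absorbed in the left
  -- factor, which still depends on `w` only.
  obtain ⟨W, hWu, hW⟩ := exists_congruence_of_eq_mul haV (K := fun z w => KT (z, conj w))
    (L := fun z w => (Φ w)ᴴ * KS (z, conj w) * Φ z)
    (fun w => KT (a, conj w) * (KS (a, conj w) * Φ a)⁻¹ * ((Φ w)ᴴ)⁻¹)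
    (fun z hz w hw => by simp [KT, crossGram_conjTranspose])
    (fun z hz w hw => by simp [KS, crossGram_conjTranspose, Matrix.conjTranspose_mul, mul_assoc])
    (hpT a ha)
    ((hpS a ha).conjTranspose_mul_mul_same (Matrix.mulVec_injective_of_isUnit (hΦu a ha)))
    (fun z hz => (((Matrix.isUnit_iff_isUnit_det _).2 (hΦh a haV)).mul
      (hball _ (hVb z hz a haV)).2.2.2).mul (hΦu z (hVU hz)))
    (fun z hz w hw => by
      simp only [hmul w hw z hz, mul_assoc, Matrix.nonsing_inv_mul_cancel_left _ _ (hΦh w hw)])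
  -- The frame of `E_S` matching `γT`. Holomorphy of `W` is not needed: only inner products between
  -- points of `V` matter.
  set δ : V → Fin n → HS := fun z => changeFrame (fun i => γS i z) (Φ z * W z)
  have hδ : ∀ z : V, ∀ i, γS i z ∈ Submodule.span ℂ (Set.range (δ z)) := by
    intro z i
    have h1 : changeFrame (δ z) (Φ z * W z)⁻¹ = fun i => γS i z := by
      rw [changeFrame_changeFrame, Matrix.mul_nonsing_inv _ ((Matrix.isUnit_iff_isUnit_det _).1
        ((hΦu z (hVU z.2)).mul (hWu z z.2))), changeFrame_one]
    rw [← congrFun h1 i]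
    exact Submodule.sum_mem _ fun j _ => Submodule.smul_mem _ _ (Submodule.subset_span ⟨j, rfl⟩)
  have heT : ∀ z ∈ Ω, ∀ i, T (γT i z) = z • γT i z := fun z hz i => by
    have h2 : γT i z ∈ Module.End.eigenspace (T : HT →ₗ[ℂ] HT) z := by
      rw [← hγT.span_eq z hz]
      exact Submodule.subset_span ⟨i, rfl⟩
    exact Module.End.mem_eigenspace_iff.1 h2
  have heS : ∀ z ∈ Ω, ∀ i, S (γS i z) = z • γS i z := fun z hz i => by
    have h2 : γS i z ∈ Module.End.eigenspace (S : HS →ₗ[ℂ] HS) z := by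
      rw [← hγS.span_eq z hz]
      exact Submodule.subset_span ⟨i, rfl⟩
    exact Module.End.mem_eigenspace_iff.1 h2
  refine unitarilyEquivalent_of_inner_eq (ι := V × Fin n) (fun p => (p.1 : ℂ))
    (fun p => γT p.2 p.1) (fun p => δ p.1 p.2) ?_ ?_ (fun p => heT _ (hUΩ (hVU p.1.2)) _) ?_ ?_
  · exact dense_span_of_isHolomorphicFrame hΩ hΩc hT hγT Metric.isOpen_ball (hVU.trans hUΩ) ⟨a, haV⟩
      fun z hz i => Submodule.subset_span ⟨(⟨z, hz⟩, i), rfl⟩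
  · refine dense_span_of_isHolomorphicFrame hΩ hΩc hS hγS Metric.isOpen_ball (hVU.trans hUΩ)
      ⟨a, haV⟩ fun z hz i => Submodule.span_mono ?_ (hδ ⟨z, hz⟩ i)
    rintro _ ⟨j, rfl⟩
    exact ⟨(⟨z, hz⟩, j), rfl⟩
  · rintro ⟨z, i⟩
    simp only [δ, changeFrame, map_sum, map_smul, heS _ (hUΩ (hVU z.2)), Finset.smul_sum]
    exact Finset.sum_congr rfl fun j _ => smul_comm _ _ _
  · rintro ⟨w, i⟩ ⟨z, j⟩
    have h1 : crossGram (δ w) (δ z) = KT (z, conj (w : ℂ)) := by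
      rw [hW z z.2 w w.2]
      simp only [δ, crossGram_changeFrame_left, crossGram_changeFrame_right, KS,
        Complex.conj_conj, Matrix.conjTranspose_mul, mul_assoc]
    have h2 := congrFun (congrFun h1 i) j
    simp only [KT, Complex.conj_conj] at h2
    exact h2.symm

theorem unitarilyEquivalent_iff_gaugeEquivalent [CompleteSpace HT] [CompleteSpace HS]
    (hΩ : IsOpen Ω) (hΩc : IsConnected Ω)
    (hT : CowenDouglas n Ω T) (hS : CowenDouglas n Ω S)
    (hγT : IsHolomorphicFrame T Ω γT) (hγS : IsHolomorphicFrame S Ω γS) :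
    UnitarilyEquivalent T S ↔ HolomorphicGaugeEquivalent Ω (connectionMatrix (gramMetric γT))
      (connectionMatrix (gramMetric γS)) :=
  ⟨gaugeEquivalent_of_unitarilyEquivalent hΩ hΩc.nonempty hγT hγS,
    unitarilyEquivalent_of_gaugeEquivalent hΩ hΩc hT hS hγT hγS⟩

end Equivalence

end Frames

end

theorem mainTheorem3 {n : ℕ} (hn : 0 < n) {Ω : Set ℂ} (hΩ : IsOpen Ω) (hΩc : IsConnected Ω)
    {HT HS : Type*}
    [NormedAddCommGroup HT] [InnerProductSpace ℂ HT] [CompleteSpace HT]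
    [RKHS ℂ HT (conjDomain Ω) (EuclideanSpace ℂ (Fin n))]
    [NormedAddCommGroup HS] [InnerProductSpace ℂ HS] [CompleteSpace HS]
    [RKHS ℂ HS (conjDomain Ω) (EuclideanSpace ℂ (Fin n))]
    (T : HT →L[ℂ] HT) (S : HS →L[ℂ] HS)
    (hT : CowenDouglas n Ω T) (hS : CowenDouglas n Ω S)
    (hKT : IsKernelRealization T) (hKS : IsKernelRealization S) :
    (UnitarilyEquivalent T S ↔
      HolomorphicGaugeEquivalent Ω
        (connectionMatrix (gramMetric (kernelFrame (n := n) (Ω := Ω) HT)))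
        (connectionMatrix (gramMetric (kernelFrame (n := n) (Ω := Ω) HS)))) ∧
    (∀ γT : Fin n → ℂ → HT, ∀ γS : Fin n → ℂ → HS,
      IsHolomorphicFrame T Ω γT → IsHolomorphicFrame S Ω γS →
      (UnitarilyEquivalent T S ↔
        HolomorphicGaugeEquivalent Ω
          (connectionMatrix (gramMetric γT)) (connectionMatrix (gramMetric γS)))) := by
  have hT' := isHolomorphicFrame_kernelFrame hΩ hT hKT
  have hS' := isHolomorphicFrame_kernelFrame hΩ hS hKS
  exact ⟨unitarilyEquivalent_iff_gaugeEquivalent hΩ hΩc hT hS hT' hS',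
    fun _ _ hγT hγS => unitarilyEquivalent_iff_gaugeEquivalent hΩ hΩc hT hS hγT hγS⟩
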